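/- Let $\Gamma$ be a finite simplicial graph with vertex set $V(\Gamma)$, let $G_\Gamma=\langle V(\Gamma)\mid [a,b]=1 \text{ for } (a,b)\in E(\Gamma)\rangle$ be its right-angled Artin group, and let $\varphi\colon G_\Gamma\to\mathbb Z$ be an epimorphism. Write $n_a=\varphi(a)\in\mathbb Z$ for $a\in V(\Gamma)$, and let $\Gamma_L$ be the subgraph induced by the vertices $a$ with $n_a\neq 0$. Call $\Gamma_L$ $0$-acyclic-dominating if every vertex of $\Gamma$ outside $\Gamma_L$ is adjacent to a vertex of $\Gamma_L$. (1) $\ker\varphi$ is finitely generated if and only if $\Gamma_L$ is connected and $0$-acyclic-dominating. (2) Suppose that $\Gamma_L$ is connected and $0$-acyclic-dominating. Let $a_1,\dots,a_\ell$ be any distinct vertices with $n_{a_j}\ne 0$, and $r_1,\dots,r_\ell$ any nonzero integers, such that $n_{a_1}r_1+\dots+n_{a_\ell}r_\ell=1$. Put $r=\max_j|r_j|$, $N=\operatorname{lcm}\{|n_a| : n_a\neq 0\}$, $w_m=a_1^{mr_1}\cdots a_\ell^{mr_\ell}$ and $x_{m,a}=w_m\,a\,w_{m+n_a}^{-1}\in\ker\varphi$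 for $m\in\mathbb Z$, $a\in V(\Gamma)$. Then $\ker\varphi$ is generated by the finitely many elements $x_{m,a}$ with $|m|<\ell rN^2$, $a\in V(\Gamma)$. Moreover, on these generators $\ker\varphi$ has the (in general infinite) presentation with relations $$x_{t,a}=\tau\bigl(w_t\,a\,w_{t+n_a}^{-1}\bigr)\quad (|t|<\ell^2r^2N^3,\ a\in V(\Gamma)),\qquad \tau\bigl(w_M[a,b]w_M^{-1}\bigr)=1\quad (M\in\mathbb Z,\ (a,b)\in E(\Gamma)).$$ Here $\tau$ is the Reidemeister rewriting process: a word $u=b_1^{\epsilon_1}\cdots b_k^{\epsilon_k}$ in the vertices ($\epsilon_j=\pm1$) is sent to $x_{k_1,b_1}^{\epsilon_1}\cdots x_{k_k,b_k}^{\epsilon_k}$, where $k_j=\varphi(b_1^{\epsilon_1}\cdots b_{j-1}^{\epsilon_{j-1}})$ if $\epsilon_j=1$ and $k_j=\varphi(b_1^{\epsilon_1}\cdots b_j^{\epsilon_j})$ if $\epsilon_j=-1$. In these relations each symbol $x_{m,a}$ with $|m|\ge \ell rN^2$ is replaced by a word in the generators that represents the element $x_{m,a}$ of $\ker\varphi$;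 such words exist, and the presentation is valid for every choice of them. -/

import Mathlib

/-- The relators `[a, b] = a b a⁻¹ b⁻¹`, one for each edge `(a, b)` of the graph. -/
def raagRels {V : Type*} (Γ : SimpleGraph V) : Set (FreeGroup V) :=
  {g | ∃ a b : V, Γ.Adj a b ∧
    g = FreeGroup.of a * FreeGroup.of b * (FreeGroup.of a)⁻¹ * (FreeGroup.of b)⁻¹}

/-- The right-angled Artin group of a simplicial graph: generated by the vertices, where adjacent
vertices commute. -/
abbrev RAAG {V : Type*} (Γ : SimpleGraph V) : Type _ := PresentedGroup (raagRels Γ)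

namespace RAAG

variable {V : Type*}

/-- The canonical projection of the free group on the vertices onto the right-angled Artin group. -/
def proj (Γ : SimpleGraph V) : FreeGroup V →* RAAG Γ := PresentedGroup.mk (raagRels Γ)

/-- The integers `n_i = φ(a_i)` attached to a character `φ`. -/
def weight {Γ : SimpleGraph V} (φ : RAAG Γ →* Multiplicative ℤ) (a : V) : ℤ :=
  (φ (proj Γ (FreeGroup.of a))).toAdd

/-- The vertices with nonzero image. -/
def living (n : V → ℤ) : Set V := {a | n a ≠ 0}

/-- A set `L` of vertices of `Γ` spans a `0`-acyclic-dominating subcomplex of the flag complex of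
`Γ`: for each vertex outside `L`, the part of its link that lies in `L` is nonempty. -/
def ZeroAcyclicDominating (Γ : SimpleGraph V) (L : Set V) : Prop :=
  ∀ a : V, a ∉ L → ∃ b ∈ L, Γ.Adj a b

/-- The least common multiple `N` of the integers `|n_i|` with `n_i ≠ 0`. -/
def lcmWeight [Fintype V] (n : V → ℤ) : ℕ :=
  (Finset.univ.filter fun a : V => n a ≠ 0).lcm fun a => (n a).natAbs

/-- The data of a word `a_1 ^ r_1 ⋯ a_ℓ ^ r_ℓ` in distinct vertices, with `r_j ≠ 0` and `n_j ≠ 0`,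
whose image `n_1 r_1 + ⋯ + n_ℓ r_ℓ` under the character is `1`. -/
structure UnitWord (n : V → ℤ) where
  /-- the number `ℓ` of syllables -/
  len : ℕ
  /-- the vertices `a_1, …, a_ℓ` -/
  vert : Fin len → V
  vert_injective : Function.Injective vert
  /-- the exponents `r_1, …, r_ℓ` -/
  exp : Fin len → ℤ
  exp_ne_zero : ∀ j, exp j ≠ 0
  weight_ne_zero : ∀ j, n (vert j) ≠ 0
  sum_eq_one : ∑ j, n (vert j) * exp j = 1

namespace UnitWord

variable {n : V → ℤ} (W : UnitWord n)

/-- `r = max |r_j|`. -/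
def maxExp : ℕ := Finset.univ.sup fun j => (W.exp j).natAbs

/-- The coset representative `w_m = a_1 ^ (m r_1) ⋯ a_ℓ ^ (m r_ℓ)`, as an element of the free
group on the vertices. -/
def w (m : ℤ) : FreeGroup V :=
  (List.ofFn fun j => FreeGroup.of (W.vert j) ^ (m * W.exp j)).prod

/-- `w_m a_i w_{m + n_i}⁻¹`, for `p = (m, a_i)`, as an element of the free group on the vertices. -/
def xFree (p : ℤ × V) : FreeGroup V :=
  W.w p.1 * FreeGroup.of p.2 * (W.w (p.1 + n p.2))⁻¹

/-- The element `x_{m,i} = w_m a_i w_{m + n_i}⁻¹` of the right-angled Artin group. -/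
def x (Γ : SimpleGraph V) (p : ℤ × V) : RAAG Γ := proj Γ (W.xFree p)

/-- The bound `ℓ r N²` for the indices `m` of the generators. -/
def genBound [Fintype V] : ℕ := W.len * W.maxExp * lcmWeight n ^ 2

/-- The bound `ℓ² r² N³` for the indices `t` of the relations `x_{t,i} = τ(w_t a_i w_{t+n_i}⁻¹)`. -/
def relBound [Fintype V] : ℕ := W.len ^ 2 * W.maxExp ^ 2 * lcmWeight n ^ 3

/-- The index set of the generators `x_{m,i}`, `|m| < ℓ r N²`. -/
abbrev Gen [Fintype V] : Type _ := {p : ℤ × V // |p.1| < (W.genBound : ℤ)}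

end UnitWord

/-- The Reidemeister rewriting process on words (lists of letters with signs), started at level
`k`. A letter `a_i` read at level `k` gives `x_{k,i}` and moves to level `k + n_i`; a letter
`a_i⁻¹` read at level `k` moves to level `k - n_i` and gives the inverse of `x_{k - n_i,i}`. -/
def rewriteWord (n : V → ℤ) : ℤ → List (V × Bool) → FreeGroup (ℤ × V)
  | _, [] => 1
  | k, (a, true) :: l => FreeGroup.of (k, a) * rewriteWord n (k + n a) l
  | k, (a, false) :: l => (FreeGroup.of (k - n a, a))⁻¹ * rewriteWord n (k - n a) l

theorem rewriteWord_step (n : V → ℤ) {l₁ l₂ : List (V × Bool)} (h : FreeGroup.Red.Step l₁ l₂)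
    (k : ℤ) : rewriteWord n k l₁ = rewriteWord n k l₂ := by
  obtain @⟨s, t, a, b⟩ := h
  induction s generalizing k with
  | nil => cases b <;> simp [rewriteWord]
  | cons c s ih =>
    obtain ⟨c, d⟩ := c
    cases d <;> simp [rewriteWord, ih]

/-- The Reidemeister rewriting process `τ`. It does not depend on the word that represents an
element of the free group on the vertices; it is meant for elements with image `0` in `ℤ`. -/
def rewrite (n : V → ℤ) : FreeGroup V → FreeGroup (ℤ × V) :=
  Quot.lift (rewriteWord n 0) fun _ _ h => rewriteWord_step n h 0

/-- A choice, for each `x_{m,i}` with `m ∈ ℤ`, of a word in the generators `x_{m,i}`,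
`|m| < ℓ r N²`, that represents it; the word chosen for a generator is the generator itself. -/
structure Expressions [Fintype V] (Γ : SimpleGraph V) {n : V → ℤ} (W : UnitWord n) where
  /-- the word that represents `x_{m,i}` -/
  word : ℤ × V → FreeGroup W.Gen
  word_gen : ∀ p : W.Gen, word p.1 = FreeGroup.of p
  word_eval : ∀ p : ℤ × V, FreeGroup.lift (fun q : W.Gen => W.x Γ q.1) (word p) = W.x Γ p

/-- The relators of the presentation, written in the generators `x_{m,i}`, `|m| < ℓ r N²`:
`x_{t,i} = τ(w_t a_i w_{t+n_i}⁻¹)` for `|t| < ℓ² r² N³`, and `τ(w_M [a_i, a_j] w_M⁻¹) = 1` for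
`M ∈ ℤ` and each edge `(a_i, a_j)`. Every `x_{m,i}` with `|m| ≥ ℓ r N²` that occurs in them is
replaced by the word chosen for it. -/
def kernelRels [Fintype V] {Γ : SimpleGraph V} {n : V → ℤ} {W : UnitWord n}
    (E : Expressions Γ W) : Set (FreeGroup W.Gen) :=
  {g | ∃ (t : ℤ) (a : V), |t| < (W.relBound : ℤ) ∧
      g = (E.word (t, a))⁻¹ * FreeGroup.lift E.word (rewrite n (W.xFree (t, a)))} ∪
  {g | ∃ (M : ℤ) (a b : V), Γ.Adj a b ∧
      g = FreeGroup.lift E.word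
        (rewrite n (W.w M * (FreeGroup.of a * FreeGroup.of b * (FreeGroup.of a)⁻¹ * (FreeGroup.of b)⁻¹) *
          (W.w M)⁻¹))}

end RAAG

/-!
Write `n_a` for the weight of a vertex `a`, call `a` living if `n_a ≠ 0` and dead otherwise, and
let `N` be the least common multiple of the `|n_a|` for living `a`.

**Presentation.** The relators `w_M [a, b] w_M⁻¹`, rewritten at all levels `M`, say exactly that the
symbols `y (M, a)` satisfy `y (M, a) y (M + n_a, b) = y (M, b) y (M + n_b, a)` on every edge
(`square_of_lift_rewriteFrom`). Whenever elements of a group `K` satisfy these squares, the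
right-angled Artin group acts on `K × ℤ`, a vertex `a` moving level `m + n_a` to level `m` with
holonomy `y (m, a)`; restricting to the kernel gives a homomorphism to `K` which is the rewriting
process followed by evaluation (`exists_kerHom`). For the presented group `K` this homomorphism
sends `x_{m,a}` to the generator of that name, by the relations `x_{t,a} = τ(w_t a w_{t+n_a}⁻¹)`,
so it is inverse to the evaluation map (`exists_kernelRels_mulEquiv`). The words chosen for the
`x_{m,a}` outside the bound play no role beyond representing the right elements.

**Generation.** Let `H` be generated by the `x_{m,a}` with `|m| < ℓ r N²`, and `P m` the coset
`w_m⁻¹ H`. Then `x_{m,a} ∈ H` means `a • P (m + n_a) = P m`. This is known for small `|m|`, and it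
has to be shown for all `m`. For a living vertex `b` the power `v_b = b ^ (N / n_b)` moves
`P (m + N)` to `P m` when `m` is small. Since adjacent `b`, `c` commute, `v_b ^ k` and `v_c ^ k` then
agree on the points of one period for all `k`; by connectedness all living vertices agree
(`smul_of_two_periods`). So these powers continue the points of one period to a periodic family,
and as every vertex commutes with some living vertex, the relations of one period spread to all
levels (`smul_of_periodic`). This family is then `P` itself (`smul_of_powers_agree`). The
argument needs two periods of levels, `2 N ≤ ℓ r N²`; the remaining case `ℓ = r = N = 1` is
`smul_of_level_zero`.

**Necessity.** If the living vertices are disconnected, or some dead vertex has no living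
neighbour, then the group acts on `ℚ` by affine maps in which `g` has slope `2 ^ φ g` and some
element of the kernel is a nontrivial translation. The translations by the kernel form a subgroup
of `ℚ` that is closed under halving, and such a nonzero subgroup is not finitely generated
(`apply_zero_eq_zero_of_ker_fg`).
-/

/-! ### The rewriting process and homomorphisms out of the kernel -/

namespace RAAG

section Rewriting

variable {V : Type*} {K : Type*} [Group K]

/-- The level reached from level `0` by reading an element of the free group on the vertices: the
homomorphism to `ℤ` that sends a vertex `a` to `n a`. -/
def level (n : V → ℤ) (u : FreeGroup V) : ℤ :=
  (FreeGroup.lift (fun a => Multiplicative.ofAdd (n a)) u).toAdd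

@[simp] theorem level_one (n : V → ℤ) : level n 1 = 0 := by simp [level]

@[simp] theorem level_mul (n : V → ℤ) (u v : FreeGroup V) :
    level n (u * v) = level n u + level n v := by simp [level]

@[simp] theorem level_inv (n : V → ℤ) (u : FreeGroup V) : level n u⁻¹ = -level n u := by
  simp [level]

@[simp] theorem level_of (n : V → ℤ) (a : V) : level n (FreeGroup.of a) = n a := by simp [level]

@[simp] theorem level_zpow (n : V → ℤ) (u : FreeGroup V) (k : ℤ) :
    level n (u ^ k) = k * level n u := by simp [level]

theorem level_prod (n : V → ℤ) (l : List (FreeGroup V)) :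
    level n l.prod = (l.map (level n)).sum := by
  induction l with
  | nil => simp
  | cons u l ih => simp [ih]

theorem toAdd_proj {Γ : SimpleGraph V} (φ : RAAG Γ →* Multiplicative ℤ) (u : FreeGroup V) :
    (φ (proj Γ u)).toAdd = level (weight φ) u := by
  have h : φ.comp (proj Γ) = FreeGroup.lift (fun a => Multiplicative.ofAdd (weight φ a)) := by
    ext a
    simp [weight]
  rw [level, ← h]
  rfl

theorem proj_mem_ker_iff {Γ : SimpleGraph V} (φ : RAAG Γ →* Multiplicative ℤ) (u : FreeGroup V) :
    proj Γ u ∈ φ.ker ↔ level (weight φ) u = 0 := by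
  rw [← toAdd_proj, MonoidHom.mem_ker]
  exact Iff.rfl

theorem proj_surjective (Γ : SimpleGraph V) : Function.Surjective (proj Γ) :=
  PresentedGroup.mk_surjective _

theorem commute_proj_of_adj {Γ : SimpleGraph V} {a b : V} (h : Γ.Adj a b) :
    Commute (proj Γ (FreeGroup.of a)) (proj Γ (FreeGroup.of b)) := by
  have := PresentedGroup.one_of_mem (rels := raagRels Γ) ⟨a, b, h, rfl⟩
  have h1 : proj Γ (FreeGroup.of a * FreeGroup.of b * (FreeGroup.of a)⁻¹ * (FreeGroup.of b)⁻¹) = 1 :=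
    this
  simp only [map_mul, map_inv] at h1
  rw [commute_iff_eq]
  rw [mul_inv_eq_one, mul_inv_eq_iff_eq_mul] at h1
  exact h1

/-- The Reidemeister rewriting process started at level `k`. -/
def rewriteFrom (n : V → ℤ) (k : ℤ) : FreeGroup V → FreeGroup (ℤ × V) :=
  Quot.lift (rewriteWord n k) fun _ _ h => rewriteWord_step n h k

theorem rewrite_eq_rewriteFrom (n : V → ℤ) (u : FreeGroup V) : rewrite n u = rewriteFrom n 0 u :=
  rfl

theorem rewriteWord_append (n : V → ℤ) (l₁ l₂ : List (V × Bool)) (k : ℤ) :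
    rewriteWord n k (l₁ ++ l₂) =
      rewriteWord n k l₁ * rewriteWord n (k + level n (FreeGroup.mk l₁)) l₂ := by
  induction l₁ generalizing k with
  | nil => simp [rewriteWord, level]
  | cons c l ih =>
    obtain ⟨c, d⟩ := c
    cases d <;> simp [rewriteWord, ih, level, FreeGroup.lift_mk, mul_assoc, add_assoc, sub_eq_add_neg]

@[simp] theorem rewriteFrom_one (n : V → ℤ) (k : ℤ) : rewriteFrom n k 1 = 1 := rfl

@[simp] theorem rewriteFrom_of (n : V → ℤ) (k : ℤ) (a : V) :
    rewriteFrom n k (FreeGroup.of a) = FreeGroup.of (k, a) := by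
  change rewriteWord n k [(a, true)] = _
  simp [rewriteWord]

/-- The rewriting process is a crossed homomorphism: the second factor is read at the level where
the first one ends. -/
theorem rewriteFrom_mul (n : V → ℤ) (k : ℤ) (u v : FreeGroup V) :
    rewriteFrom n k (u * v) = rewriteFrom n k u * rewriteFrom n (k + level n u) v := by
  obtain ⟨l₁, rfl⟩ := Quot.exists_rep u
  obtain ⟨l₂, rfl⟩ := Quot.exists_rep v
  exact rewriteWord_append n l₁ l₂ k

theorem rewriteFrom_inv (n : V → ℤ) (k : ℤ) (u : FreeGroup V) :
    rewriteFrom n k u⁻¹ = (rewriteFrom n (k - level n u) u)⁻¹ := by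
  rw [eq_inv_iff_mul_eq_one]
  have := rewriteFrom_mul n k u⁻¹ u
  simpa [← sub_eq_add_neg] using this.symm

/-- Evaluation of rewritten words: if `y (m, a) = p m * f a * (p (m + n a))⁻¹`, then these products
telescope along every word. -/
theorem lift_rewriteFrom (n : V → ℤ) (f : FreeGroup V →* K) (p : ℤ → K) (k : ℤ)
    (u : FreeGroup V) :
    FreeGroup.lift (fun q : ℤ × V => p q.1 * f (FreeGroup.of q.2) * (p (q.1 + n q.2))⁻¹)
      (rewriteFrom n k u) = p k * f u * (p (k + level n u))⁻¹ := by
  induction u using FreeGroup.induction_on generalizing k with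
  | C1 => simp
  | of a => simp
  | inv_of a _ => simp [rewriteFrom_inv, mul_assoc, sub_eq_add_neg]
  | mul u v hu hv =>
    rw [rewriteFrom_mul, map_mul, hu, hv]
    simp [mul_assoc, add_assoc]

/-- The square relation at level `M`, obtained from the rewritten relator `u [a, b] u⁻¹` for any
`u` that ends at level `M`. -/
theorem square_of_lift_rewriteFrom {n : V → ℤ} {y : ℤ × V → K} {u : FreeGroup V} {M : ℤ}
    (hu : level n u = M) {a b : V}
    (h : FreeGroup.lift y (rewriteFrom n 0 (u * (FreeGroup.of a * FreeGroup.of b *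
      (FreeGroup.of a)⁻¹ * (FreeGroup.of b)⁻¹) * u⁻¹)) = 1) :
    y (M, a) * y (M + n a, b) = y (M, b) * y (M + n b, a) := by
  have e1 : M + n a + n b - n a = M + n b := by ring
  have e2 : M + (n a + n b - n a) - n b = M := by ring
  have e3 : M + (n a + n b - n a - n b) - M = 0 := by ring
  simp only [rewriteFrom_mul, rewriteFrom_inv, rewriteFrom_of, level_mul, level_inv, level_of, hu,
    map_mul, map_inv, FreeGroup.lift_apply_of, zero_add, ← add_assoc, ← sub_eq_add_neg, e1, e2,
    e3] at h
  rw [conj_eq_one_iff] at h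
  rw [mul_inv_eq_one, mul_inv_eq_iff_eq_mul] at h
  exact h

/-- The permutation of `K × ℤ` attached to a vertex `a`: it moves level `m + n a` to level `m` and
multiplies by `y (m, a)` on the left. -/
def stepPerm (n : V → ℤ) (y : ℤ × V → K) (a : V) : Equiv.Perm (K × ℤ) where
  toFun q := (y (q.2 - n a, a) * q.1, q.2 - n a)
  invFun q := ((y (q.2, a))⁻¹ * q.1, q.2 + n a)
  left_inv q := by simp
  right_inv q := by simp

theorem lift_stepPerm_apply (n : V → ℤ) (y : ℤ × V → K) (u : FreeGroup V) (k : K) (m : ℤ) :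
    FreeGroup.lift (stepPerm n y) u (k, m + level n u) =
      (FreeGroup.lift y (rewriteFrom n m u) * k, m) := by
  induction u using FreeGroup.induction_on generalizing k m with
  | C1 => simp
  | of a => simp [stepPerm]
  | inv_of a _ =>
    rw [map_inv, Equiv.Perm.inv_eq_iff_eq]
    simp [stepPerm, rewriteFrom_inv, sub_eq_add_neg]
  | mul u v hu hv =>
    rw [map_mul, Equiv.Perm.mul_apply, level_mul, ← add_assoc, hv, hu, rewriteFrom_mul]
    simp [mul_assoc]

/-- Elements `y (m, a)` of a group `K` that satisfy the square relations of all edges at all levels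
extend, through the rewriting process, to a homomorphism from the kernel of the character to `K`.
The squares say that `stepPerm` defines an action of the right-angled Artin group on `K × ℤ`; it
commutes with right multiplication by `K`, and the kernel preserves the levels. -/
theorem exists_kerHom {Γ : SimpleGraph V} (φ : RAAG Γ →* Multiplicative ℤ) (y : ℤ × V → K)
    (hy : ∀ (m : ℤ) (a b : V), Γ.Adj a b →
      y (m, a) * y (m + weight φ a, b) = y (m, b) * y (m + weight φ b, a)) :
    ∃ ψ : φ.ker →* K, ∀ (u : FreeGroup V) (hu : proj Γ u ∈ φ.ker),
      ψ ⟨proj Γ u, hu⟩ = FreeGroup.lift y (rewriteFrom (weight φ) 0 u) := by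
  have hrel : ∀ g ∈ raagRels Γ, FreeGroup.lift (stepPerm (weight φ) y) g = 1 := by
    rintro g ⟨a, b, hab, rfl⟩
    have e : ∀ m : ℤ, m + weight φ a + weight φ b - weight φ a = m + weight φ b := fun m => by ring
    have e' : ∀ m : ℤ, m + (weight φ a + weight φ b - weight φ a) - weight φ b = m :=
      fun m => by ring
    ext1 ⟨k, m⟩
    have h := lift_stepPerm_apply (weight φ) y
      (FreeGroup.of a * FreeGroup.of b * (FreeGroup.of a)⁻¹ * (FreeGroup.of b)⁻¹) k m
    have h0 : level (weight φ)
      (FreeGroup.of a * FreeGroup.of b * (FreeGroup.of a)⁻¹ * (FreeGroup.of b)⁻¹) = 0 := by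
      simp
    rw [h0, add_zero] at h
    rw [h]
    simp only [rewriteFrom_mul, rewriteFrom_inv, rewriteFrom_of, level_mul, level_inv, level_of,
      map_mul, map_inv, FreeGroup.lift_apply_of, ← add_assoc, ← sub_eq_add_neg, e, e']
    simp [hy m a b hab]
  -- For `g` in the kernel, `ρ g` preserves levels, and `ψ g` is the holonomy along `g` at level `0`.
  let ρ : RAAG Γ →* Equiv.Perm (K × ℤ) := PresentedGroup.toGroup hrel
  have hρ : ∀ u : FreeGroup V, ρ (proj Γ u) = FreeGroup.lift (stepPerm (weight φ) y) u :=
    fun u => rfl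
  have key : ∀ (u : FreeGroup V), proj Γ u ∈ φ.ker →
      (ρ (proj Γ u) (1, 0)).1 = FreeGroup.lift y (rewriteFrom (weight φ) 0 u) := by
    intro u hu
    rw [proj_mem_ker_iff] at hu
    have h := lift_stepPerm_apply (weight φ) y u 1 0
    rw [hu, add_zero] at h
    rw [hρ, h, mul_one]
  refine ⟨MonoidHom.mk' (fun g => (ρ g (1, 0)).1) ?_, fun u hu => key u hu⟩
  rintro ⟨g, hg⟩ ⟨h, hh⟩
  obtain ⟨u, rfl⟩ := proj_surjective Γ g
  obtain ⟨v, rfl⟩ := proj_surjective Γ h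
  have huv : proj Γ (u * v) ∈ φ.ker := by
    rw [map_mul]
    exact mul_mem hg hh
  have h1 := key _ huv
  rw [map_mul] at h1
  simp only [Subgroup.coe_mul]
  rw [h1, key _ hg, key _ hh, rewriteFrom_mul, (proj_mem_ker_iff φ u).1 hg, add_zero, map_mul]

end Rewriting

/-! ### The presentation of the kernel -/

namespace UnitWord

variable {V : Type*} {n : V → ℤ} (W : UnitWord n)

@[simp] theorem level_w (m : ℤ) : level n (W.w m) = m := by
  rw [w, level_prod, List.map_ofFn, List.sum_ofFn]
  have : ∀ j, (level n ∘ fun j => FreeGroup.of (W.vert j) ^ (m * W.exp j)) j =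
      m * (n (W.vert j) * W.exp j) := by
    intro j
    simp only [Function.comp_apply, level_zpow, level_of]
    ring
  rw [Finset.sum_congr rfl fun j _ => this j, ← Finset.mul_sum, W.sum_eq_one, mul_one]

@[simp] theorem w_zero : W.w 0 = 1 := by
  simp [w, List.ofFn_const]

@[simp] theorem level_xFree (p : ℤ × V) : level n (W.xFree p) = 0 := by
  simp [xFree]

theorem x_mem_ker {Γ : SimpleGraph V} {φ : RAAG Γ →* Multiplicative ℤ} (W : UnitWord (weight φ))
    (p : ℤ × V) : W.x Γ p ∈ φ.ker :=
  (proj_mem_ker_iff φ _).2 (W.level_xFree p)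

/-- Rewriting and then evaluating the symbols `x_{m,a}` gives back every element of the kernel. -/
theorem lift_x_rewrite (Γ : SimpleGraph V) {u : FreeGroup V} (hu : level n u = 0) :
    FreeGroup.lift (W.x Γ) (rewrite n u) = proj Γ u := by
  have h := lift_rewriteFrom n (proj Γ) (fun m => proj Γ (W.w m)) 0 u
  have hx : W.x Γ = fun q : ℤ × V => proj Γ (W.w q.1) * proj Γ (FreeGroup.of q.2) *
      (proj Γ (W.w (q.1 + n q.2)))⁻¹ := by
    funext q
    simp [x, xFree]
  rw [rewrite_eq_rewriteFrom, hx, h]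
  simp [hu]

theorem len_pos : 0 < W.len := by
  rcases Nat.eq_zero_or_pos W.len with h | h
  · have := W.sum_eq_one
    have : IsEmpty (Fin W.len) := by rw [h]; infer_instance
    simp_all
  · exact h

theorem maxExp_pos : 0 < W.maxExp :=
  (Int.natAbs_pos.2 (W.exp_ne_zero ⟨0, W.len_pos⟩)).trans_le
    (Finset.le_sup (f := fun j => (W.exp j).natAbs) (Finset.mem_univ _))

theorem lcmWeight_pos [Fintype V] (n : V → ℤ) : 0 < lcmWeight n := by
  refine Nat.pos_of_ne_zero fun h => ?_
  obtain ⟨a, ha, h0⟩ := Finset.lcm_eq_zero_iff.1 h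
  simp at ha h0
  exact ha h0

theorem genBound_le_relBound [Fintype V] : W.genBound ≤ W.relBound := by
  have h1 := W.len_pos
  have h2 := W.maxExp_pos
  have h3 := lcmWeight_pos n
  have : W.relBound = W.genBound * (W.len * W.maxExp * lcmWeight n) := by
    simp only [relBound, genBound]
    ring
  rw [this]
  exact Nat.le_mul_of_pos_right _ (by positivity)

end UnitWord

/-- The presentation of the kernel on finitely many generators. The square relations at all levels
give a homomorphism back to the presented group, and the relations `x_{t,a} = τ(w_t a w_{t+n_a}⁻¹)`
for the generators alone make it the inverse of the evaluation map. -/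
theorem exists_kernelRels_mulEquiv {V : Type*} [Fintype V] {Γ : SimpleGraph V}
    {φ : RAAG Γ →* Multiplicative ℤ} {W : UnitWord (weight φ)}
    (hgen : φ.ker ≤ Subgroup.closure
      {g | ∃ (m : ℤ) (a : V), |m| < (W.genBound : ℤ) ∧ g = W.x Γ (m, a)})
    (E : Expressions Γ W) :
    ∃ e : PresentedGroup (kernelRels E) ≃* φ.ker,
      ∀ p : W.Gen, (e (PresentedGroup.of p) : RAAG Γ) = W.x Γ p.1 := by
  let f : W.Gen → φ.ker := fun p => ⟨W.x Γ p.1, W.x_mem_ker p.1⟩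
  have hword : ∀ p, (FreeGroup.lift f (E.word p) : RAAG Γ) = W.x Γ p := by
    intro p
    have : φ.ker.subtype.comp (FreeGroup.lift f) =
        FreeGroup.lift (fun q : W.Gen => W.x Γ q.1) := by
      ext q
      simp [f]
    rw [← E.word_eval p, ← this]
    rfl
  have hlift : ∀ v : FreeGroup (ℤ × V),
      (FreeGroup.lift f (FreeGroup.lift E.word v) : RAAG Γ) = FreeGroup.lift (W.x Γ) v := by
    intro v
    have : (φ.ker.subtype.comp (FreeGroup.lift f)).comp (FreeGroup.lift E.word) =
        FreeGroup.lift (W.x Γ) := by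
      ext q
      simp [hword]
    rw [← this]
    rfl
  have hrel : ∀ r ∈ kernelRels E, FreeGroup.lift f r = 1 := by
    rintro r (⟨t, a, -, rfl⟩ | ⟨M, a, b, hab, rfl⟩)
    · apply Subtype.ext
      rw [map_mul, map_inv, Subgroup.coe_mul, Subgroup.coe_inv, hword, hlift,
        W.lift_x_rewrite Γ (W.level_xFree _)]
      exact inv_mul_cancel _
    · apply Subtype.ext
      rw [hlift, W.lift_x_rewrite Γ (by simp)]
      simp [(commute_proj_of_adj hab).eq]
  let η : PresentedGroup (kernelRels E) →* φ.ker := PresentedGroup.toGroup hrel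
  have hη : ∀ p, η (PresentedGroup.of p) = f p := fun p => PresentedGroup.toGroup.of hrel
  let y : ℤ × V → PresentedGroup (kernelRels E) := fun p => PresentedGroup.mk _ (E.word p)
  have hyl : ∀ v, PresentedGroup.mk (kernelRels E) (FreeGroup.lift E.word v) =
      FreeGroup.lift y v := by
    intro v
    have : (PresentedGroup.mk (kernelRels E)).comp (FreeGroup.lift E.word) =
        FreeGroup.lift y := by
      ext q
      simp [y]
    rw [← this]
    rfl
  obtain ⟨ψ, hψ⟩ := exists_kerHom φ y (by
    intro m a b hab
    refine square_of_lift_rewriteFrom (W.level_w m) ?_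
    rw [← hyl]
    exact PresentedGroup.one_of_mem (Or.inr ⟨m, a, b, hab, rfl⟩))
  -- Only here do the relations `x_{t,a} = τ(w_t a w_{t+n_a}⁻¹)` enter, and only for generators.
  have hψx : ∀ p : W.Gen, ψ (f p) = PresentedGroup.of p := by
    intro p
    have h1 : ψ (f p) = FreeGroup.lift y (rewriteFrom (weight φ) 0 (W.xFree p.1)) :=
      hψ _ (W.x_mem_ker p.1)
    have h2 : (PresentedGroup.mk (kernelRels E)) ((E.word p.1)⁻¹ *
        FreeGroup.lift E.word (rewrite (weight φ) (W.xFree p.1))) = 1 :=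
      PresentedGroup.one_of_mem (Or.inl ⟨p.1.1, p.1.2,
        p.2.trans_le (by exact_mod_cast W.genBound_le_relBound), rfl⟩)
    rw [map_mul, map_inv, inv_mul_eq_one, hyl, E.word_gen] at h2
    rw [h1]
    exact h2.symm
  have h1 : ψ.comp η = MonoidHom.id _ := by
    ext p
    simp [hη, hψx]
  have hsurj : Function.Surjective η := by
    have hle : φ.ker ≤ (φ.ker.subtype.comp η).range := by
      refine hgen.trans ((Subgroup.closure_le _).2 ?_)
      rintro _ ⟨m, a, hm, rfl⟩
      exact ⟨PresentedGroup.of ⟨(m, a), hm⟩, by simp [hη, f]⟩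
    rintro ⟨g, hg⟩
    obtain ⟨q, hq⟩ := hle hg
    exact ⟨q, Subtype.ext hq⟩
  refine ⟨MulEquiv.ofBijective η ⟨?_, hsurj⟩, fun p => ?_⟩
  · exact Function.LeftInverse.injective (g := ψ) fun q => DFunLike.congr_fun h1 q
  · exact congrArg Subtype.val (hη p)

/-- If the finitely many `x_{m,a}` generate the kernel, then every `x_{m,a}` is a word in them. -/
theorem nonempty_expressions {V : Type*} [Fintype V] {Γ : SimpleGraph V}
    {φ : RAAG Γ →* Multiplicative ℤ} {W : UnitWord (weight φ)}
    (hgen : φ.ker ≤ Subgroup.closure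
      {g | ∃ (m : ℤ) (a : V), |m| < (W.genBound : ℤ) ∧ g = W.x Γ (m, a)}) :
    Nonempty (Expressions Γ W) := by
  classical
  have h : ∀ p : ℤ × V, ∃ v : FreeGroup W.Gen,
      FreeGroup.lift (fun q : W.Gen => W.x Γ q.1) v = W.x Γ p := by
    intro p
    have hle : Subgroup.closure
        {g | ∃ (m : ℤ) (a : V), |m| < (W.genBound : ℤ) ∧ g = W.x Γ (m, a)} ≤
        (FreeGroup.lift (fun q : W.Gen => W.x Γ q.1)).range := by
      refine (Subgroup.closure_le _).2 ?_
      rintro _ ⟨m, a, hm, rfl⟩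
      exact ⟨FreeGroup.of ⟨(m, a), hm⟩, by simp⟩
    exact hle (hgen (W.x_mem_ker p))
  choose v hv using h
  refine ⟨⟨fun p => if hp : |p.1| < (W.genBound : ℤ) then FreeGroup.of ⟨p, hp⟩ else v p, ?_, ?_⟩⟩
  · intro p
    exact dif_pos p.2
  · intro p
    split_ifs with hp
    · simp
    · exact hv p

end RAAG

/-! ### Generation of the kernel by few elements -/

namespace RAAG

section Action

variable {G Y : Type*} [Group G] [MulAction G Y]

/-- If `g` moves `P (i + d)` to `P i` for all `i` between `lo` and `hi`, then `g ^ k` moves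
`P (p + k d)` to `P p` as long as both ends lie between `lo` and `hi`. -/
theorem zpow_smul_of_forall_mem_Icc {P : ℤ → Y} {g : G} {d lo hi : ℤ}
    (h : ∀ i, lo ≤ i → i ≤ hi → g • P (i + d) = P i) {k p q : ℤ} (hq : q = p + k * d)
    (hlp : lo ≤ p) (hph : p ≤ hi) (hlq : lo ≤ q) (hqh : q ≤ hi) : g ^ k • P q = P p := by
  have main : ∀ (j : ℕ) (p : ℤ), lo ≤ p → p ≤ hi → lo ≤ p + j * d → p + j * d ≤ hi →
      g ^ j • P (p + j * d) = P p := by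
    intro j
    induction j with
    | zero => intro p _ _ _ _; simp
    | succ j ih =>
      intro p h1 h2 h3 h4
      push_cast at h3 h4 ⊢
      have hmid : lo ≤ p + j * d ∧ p + j * d ≤ hi := by
        have hj : (0 : ℤ) ≤ j := Int.natCast_nonneg j
        rcases le_total 0 d with hd | hd
        · have := mul_nonneg hj hd
          constructor <;> linarith
        · have := mul_nonpos_of_nonneg_of_nonpos hj hd
          constructor <;> linarith
      rw [pow_succ, mul_smul, show p + ((j : ℤ) + 1) * d = p + j * d + d by ring,
        h _ hmid.1 hmid.2, ih p h1 h2 hmid.1 hmid.2]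
  subst hq
  obtain ⟨j, rfl | rfl⟩ := k.eq_nat_or_neg
  · rw [zpow_natCast]
    exact main j p hlp hph hlq hqh
  · have := main j (p + -j * d) hlq hqh (by linarith) (by linarith)
    rw [zpow_neg, zpow_natCast, inv_smul_eq_iff, ← this]
    congr 2
    ring

/-- Commuting elements that agree at a point with value `y` have powers that agree at `y`. -/
theorem zpow_smul_eq_of_commute {g h : G} (hc : Commute g h) {y z : Y} (hg : g • z = y)
    (hh : h • z = y) (k : ℤ) : g ^ k • y = h ^ k • y := by
  have h1 : h⁻¹ * g ∈ MulAction.stabilizer G y := by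
    rw [MulAction.mem_stabilizer_iff, mul_smul, inv_smul_eq_iff]
    nth_rewrite 1 [← hh]
    rw [← mul_smul, hc.eq, mul_smul, hg]
  have h2 := zpow_mem h1 k
  rw [(hc.symm.inv_left).mul_zpow, inv_zpow, MulAction.mem_stabilizer_iff, mul_smul,
    inv_smul_eq_iff] at h2
  exact h2

end Action

section Levels

variable {V : Type*} {Γ : SimpleGraph V} {n : V → ℤ} {Y : Type*} [MulAction (RAAG Γ) Y]

theorem induction_of_connected {S : Set V} (hconn : (Γ.induce S).Connected) {C : V → Prop}
    {a : V} (ha : a ∈ S) (h0 : C a)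
    (hstep : ∀ b ∈ S, ∀ c ∈ S, Γ.Adj b c → C b → C c) : ∀ b ∈ S, C b := by
  intro b hb
  obtain ⟨p⟩ := hconn.preconnected ⟨a, ha⟩ ⟨b, hb⟩
  have : ∀ u v : S, (Γ.induce S).Walk u v → C u → C v := by
    intro u v p
    induction p with
    | nil => exact id
    | @cons u v w h _ ih => exact fun hu => ih (hstep u u.2 v v.2 (by simpa using h) hu)
  exact this _ _ p h0

/-- If every vertex `a` moves `P (m + n a)` to `P m` at all levels `m`, then every word that leads
from level `m` to level `m'` moves `P m'` to `P m`. -/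
theorem proj_smul_of_forall_vertex {P : ℤ → Y}
    (h : ∀ a m, proj Γ (FreeGroup.of a) • P (m + n a) = P m) (u : FreeGroup V) (m : ℤ) :
    proj Γ u • P (m + level n u) = P m := by
  induction u using FreeGroup.induction_on generalizing m with
  | C1 => simp
  | of a => simpa using h a m
  | inv_of a _ =>
    rw [map_inv, inv_smul_eq_iff]
    have := h a (m + -n a)
    simp at this
    simpa using this.symm
  | mul u v hu hv => rw [map_mul, mul_smul, level_mul, ← add_assoc, hv, hu]

/-- Powers `b ^ (e b)` of the living vertices that shift the levels by the same period `N` spread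
the relations of one period to all levels: every vertex commutes with some living vertex. -/
theorem smul_of_periodic (hdom : ZeroAcyclicDominating Γ (living n)) {N : ℤ} (hN : 0 < N)
    {e : V → ℤ} {Q : ℤ → Y}
    (hper : ∀ b ∈ living n, ∀ m, proj Γ (FreeGroup.of b) ^ e b • Q (m + N) = Q m)
    (hQ : ∀ a m, 0 ≤ m → m < N → proj Γ (FreeGroup.of a) • Q (m + n a) = Q m) (a : V) (m : ℤ) :
    proj Γ (FreeGroup.of a) • Q (m + n a) = Q m := by
  obtain ⟨b, hb, hc⟩ : ∃ b ∈ living n,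
      Commute (proj Γ (FreeGroup.of a)) (proj Γ (FreeGroup.of b)) := by
    by_cases ha : a ∈ living n
    · exact ⟨a, ha, Commute.refl _⟩
    · obtain ⟨b, hb, hab⟩ := hdom a ha
      exact ⟨b, hb, commute_proj_of_adj hab⟩
  have hpow : ∀ k m : ℤ, Q (m + k * N) = (proj Γ (FreeGroup.of b) ^ e b) ^ (-k) • Q m := by
    intro k m
    have : (proj Γ (FreeGroup.of b) ^ e b) ^ k • Q (m + k * N) = Q m :=
      zpow_smul_of_forall_mem_Icc (lo := min m (m + k * N)) (hi := max m (m + k * N))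
        (fun i _ _ => hper b hb i) rfl (min_le_left _ _) (le_max_left _ _) (min_le_right _ _)
        (le_max_right _ _)
    rw [zpow_neg, eq_inv_smul_iff, this]
  have e1 : m = m % N + m / N * N := by
    rw [mul_comm, Int.emod_add_mul_ediv]
  have e2 : m + n a = (m % N + n a) + m / N * N := by
    linarith
  rw [e2, hpow, ← mul_smul, ((hc.zpow_right _).zpow_right _).eq, mul_smul,
    hQ a _ (Int.emod_nonneg _ hN.ne') (Int.emod_lt_of_pos _ hN), ← hpow, ← e1]

/-- The points `P m` of one period determine a family `Q` that is periodic for all the elements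
`b ^ (e b)`. If it agrees with `P` near this period, then it satisfies the relations of all
vertices at all levels, and so it agrees with `P` everywhere. -/
theorem smul_of_powers_agree (hdom : ZeroAcyclicDominating Γ (living n)) {N : ℤ} (hN : 0 < N)
    (hle : ∀ a, |n a| ≤ N) (W : UnitWord n) {e : V → ℤ} {P : ℤ → Y}
    (hP : ∀ m, proj Γ (W.w m) • P m = P 0) (a₀ : V)
    (hpow : ∀ b ∈ living n, ∀ k m : ℤ, 0 ≤ m → m < N →
      (proj Γ (FreeGroup.of b) ^ e b) ^ k • P m = (proj Γ (FreeGroup.of a₀) ^ e a₀) ^ k • P m)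
    (hQP : ∀ m, -N ≤ m → m < 2 * N →
      (proj Γ (FreeGroup.of a₀) ^ e a₀) ^ (-(m / N)) • P (m % N) = P m)
    (hgood : ∀ a m, 0 ≤ m → m < N → proj Γ (FreeGroup.of a) • P (m + n a) = P m) (a : V) (m : ℤ) :
    proj Γ (FreeGroup.of a) • P (m + n a) = P m := by
  let Q : ℤ → Y := fun m => (proj Γ (FreeGroup.of a₀) ^ e a₀) ^ (-(m / N)) • P (m % N)
  have hper : ∀ b ∈ living n, ∀ m, proj Γ (FreeGroup.of b) ^ e b • Q (m + N) = Q m := by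
    intro b hb m
    have hr0 := Int.emod_nonneg m hN.ne'
    have hr1 := Int.emod_lt_of_pos m hN
    change _ • _ ^ (-((m + N) / N)) • P ((m + N) % N) = _ ^ (-(m / N)) • P (m % N)
    rw [Int.add_emod_right, Int.add_ediv_of_dvd_right dvd_rfl, Int.ediv_self hN.ne',
      ← hpow b hb _ _ hr0 hr1, ← hpow b hb _ _ hr0 hr1, ← mul_smul, ← zpow_one_add]
    congr 2
    ring
  have hQ : ∀ a m, proj Γ (FreeGroup.of a) • Q (m + n a) = Q m := by
    refine smul_of_periodic hdom hN hper fun a m h0 h1 => ?_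
    have ha := abs_le.1 (hle a)
    have e1 : Q (m + n a) = P (m + n a) := hQP _ (by linarith) (by linarith)
    have e2 : Q m = P m := hQP _ (by linarith) (by linarith)
    rw [e1, e2, hgood a m h0 h1]
  have hPQ : ∀ m, P m = Q m := by
    intro m
    have h1 := proj_smul_of_forall_vertex hQ (W.w m) 0
    have h2 : Q 0 = P 0 := hQP _ (by linarith) (by linarith)
    rw [W.level_w, zero_add, h2, ← hP m] at h1
    exact ((smul_left_cancel_iff _).1 h1).symm
  rw [hPQ, hPQ, hQ]

end Levels

section Bound

variable {V : Type*} [Fintype V] {Γ : SimpleGraph V} {n : V → ℤ} {Y : Type*} [MulAction (RAAG Γ) Y]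

theorem weight_dvd_lcmWeight {a : V} (ha : n a ≠ 0) : n a ∣ (lcmWeight n : ℤ) := by
  rw [← Int.natAbs_dvd, Int.natCast_dvd_natCast]
  exact Finset.dvd_lcm (by simpa using ha)

theorem abs_weight_le_lcmWeight (a : V) : |n a| ≤ (lcmWeight n : ℤ) := by
  have hN : (0 : ℤ) < lcmWeight n := by exact_mod_cast UnitWord.lcmWeight_pos n
  by_cases ha : n a = 0
  · rw [ha, abs_zero]
    exact hN.le
  · exact Int.le_of_dvd hN ((abs_dvd _ _).2 (weight_dvd_lcmWeight ha))

/-- Two periods of levels suffice: within them the powers `b ^ (N / n_b)` of adjacent living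
vertices agree on the points of one period. -/
theorem smul_of_two_periods (hconn : (Γ.induce (living n)).Connected)
    (hdom : ZeroAcyclicDominating Γ (living n)) (W : UnitWord n) {P : ℤ → Y}
    (hP : ∀ m, proj Γ (W.w m) • P m = P 0)
    (hgood : ∀ a m, |m| < 2 * (lcmWeight n : ℤ) → proj Γ (FreeGroup.of a) • P (m + n a) = P m)
    (a : V) (m : ℤ) : proj Γ (FreeGroup.of a) • P (m + n a) = P m := by
  have hN : (0 : ℤ) < lcmWeight n := by exact_mod_cast UnitWord.lcmWeight_pos n
  -- `e b` is an exact quotient for the living vertices, the only ones at which it is used.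
  generalize hNdef : (lcmWeight n : ℤ) = N at hN hgood
  let e : V → ℤ := fun b => N / n b
  have he : ∀ b ∈ living n, e b * n b = N := fun b hb =>
    Int.ediv_mul_cancel (hNdef ▸ weight_dvd_lcmWeight hb)
  have hshift : ∀ b ∈ living n, ∀ m, -N ≤ m → m < N →
      proj Γ (FreeGroup.of b) ^ e b • P (m + N) = P m := by
    intro b hb m h0 h1
    refine zpow_smul_of_forall_mem_Icc (d := n b) (lo := -N) (hi := 2 * N - 1)
      (fun i hi1 hi2 => hgood b i (abs_lt.2 ⟨by linarith, by linarith⟩)) ?_ h0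
      (by linarith) (by linarith) (by linarith)
    rw [he b hb]
  obtain ⟨⟨a₀, ha₀⟩⟩ := hconn.nonempty
  refine smul_of_powers_agree hdom hN (fun a => hNdef ▸ abs_weight_le_lcmWeight a) W (e := e) hP a₀
    ?_ ?_ (fun a m h0 h1 => hgood a m (abs_lt.2 ⟨by linarith, by linarith⟩)) a m
  · refine induction_of_connected hconn ha₀ (fun _ _ _ _ => rfl) ?_
    intro b hb c hc hbc ih k m h0 h1
    rw [← ih k m h0 h1]
    exact zpow_smul_eq_of_commute (((commute_proj_of_adj hbc.symm).zpow_left _).zpow_right _)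
      (hshift c hc m (by linarith) h1) (hshift b hb m (by linarith) h1) k
  -- A level in `[-N, 2N)` lies in the period `[0, N)` or in one of its two neighbours.
  · intro m h0 h1
    have e1 := Int.emod_add_mul_ediv m N
    have e2 := Int.emod_nonneg m hN.ne'
    have e3 := Int.emod_lt_of_pos m hN
    generalize m / N = j at *
    generalize m % N = i at *
    have hj1 : -2 < j := by
      by_contra! h
      nlinarith
    have hj2 : j < 2 := by
      by_contra! h
      nlinarith
    obtain rfl | rfl | rfl : j = -1 ∨ j = 0 ∨ j = 1 := by omega
    · have := hshift a₀ ha₀ m (by linarith) (by linarith)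
      rw [show m + N = i by linarith] at this
      simpa using this
    · rw [show m = i by linarith]
      simp
    · have := hshift a₀ ha₀ i (by linarith) (by linarith)
      rw [show i + N = m by linarith] at this
      rw [← this]
      simp

theorem UnitWord.w_eq_zpow {V : Type*} {n : V → ℤ} (W : UnitWord n) (h : W.len = 1) :
    ∃ j, n (W.vert j) * W.exp j = 1 ∧
      ∀ m, W.w m = FreeGroup.of (W.vert j) ^ (m * W.exp j) := by
  obtain ⟨len, vert, hinj, exp, h1, h2, hsum⟩ := W
  dsimp only at h
  subst h
  exact ⟨0, by simpa using hsum, fun m => by simp [UnitWord.w]⟩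

/-- When all weights are `0`, `1` or `-1` and `w_m` is a power of one vertex, level `0` suffices:
the powers of a living vertex agree with those of the vertex in `w_m`, by induction along a path. -/
theorem smul_of_level_zero (hconn : (Γ.induce (living n)).Connected)
    (hdom : ZeroAcyclicDominating Γ (living n)) (W : UnitWord n) (hlen : W.len = 1)
    (hlcm : lcmWeight n = 1) {P : ℤ → Y} (hP : ∀ m, proj Γ (W.w m) • P m = P 0)
    (hgood : ∀ a, proj Γ (FreeGroup.of a) • P (n a) = P 0)
    (a : V) (m : ℤ) : proj Γ (FreeGroup.of a) • P (m + n a) = P m := by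
  obtain ⟨j, hj, hw⟩ := W.w_eq_zpow hlen
  have hexp : W.exp j = n (W.vert j) := by
    rcases Int.mul_eq_one_iff_eq_one_or_neg_one.1 hj with ⟨h1, h2⟩ | ⟨h1, h2⟩ <;> rw [h1, h2]
  have hroot : ∀ m, (proj Γ (FreeGroup.of (W.vert j)) ^ n (W.vert j)) ^ (-m) • P 0 = P m := by
    intro m
    rw [zpow_neg, inv_smul_eq_iff, ← hP m, hw, hexp, map_zpow, mul_comm, zpow_mul]
  have hunit : ∀ b ∈ living n, n b * n b = 1 := by
    intro b hb
    have h := weight_dvd_lcmWeight (n := n) hb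
    rw [hlcm, Nat.cast_one] at h
    rcases Int.isUnit_iff.1 (isUnit_of_dvd_one h) with h | h <;> rw [h] <;> rfl
  refine smul_of_powers_agree hdom one_pos (fun a => ?_) W (e := n) hP (W.vert j) ?_ ?_ ?_ a m
  · simpa [hlcm] using abs_weight_le_lcmWeight (n := n) a
  · refine induction_of_connected hconn (W.weight_ne_zero j) (fun _ _ _ _ => rfl) ?_
    intro b hb c hc hbc ih k m h0 h1
    obtain rfl : m = 0 := by omega
    have hb' : (proj Γ (FreeGroup.of b) ^ n b) ^ n c • P (n c) = P 0 := by
      rw [← hroot (n c), ← ih (-n c) 0 le_rfl one_pos, ← mul_smul, ← zpow_add]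
      simp
    have := zpow_smul_eq_of_commute (((commute_proj_of_adj hbc.symm).zpow_right _).zpow_right _)
      (hgood c) hb' (n c * k)
    rw [← zpow_mul, this, ← ih k 0 le_rfl one_pos, ← zpow_mul, ← mul_assoc, hunit c hc, one_mul]
  · intro m _ _
    simpa using hroot m
  · intro a m h0 h1
    obtain rfl : m = 0 := by omega
    simpa using hgood a

/-- The bound `ℓ r N²` is at least `2 N` unless `ℓ = r = N = 1`, where it is `1`. -/
theorem smul_of_lt_genBound (hconn : (Γ.induce (living n)).Connected)
    (hdom : ZeroAcyclicDominating Γ (living n)) (W : UnitWord n) {P : ℤ → Y}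
    (hP : ∀ m, proj Γ (W.w m) • P m = P 0)
    (hgood : ∀ a m, |m| < (W.genBound : ℤ) → proj Γ (FreeGroup.of a) • P (m + n a) = P m)
    (a : V) (m : ℤ) : proj Γ (FreeGroup.of a) • P (m + n a) = P m := by
  have h1 := W.len_pos
  have h2 := W.maxExp_pos
  have h3 := UnitWord.lcmWeight_pos n
  have hB : W.genBound = W.len * W.maxExp * lcmWeight n * lcmWeight n := by
    simp only [UnitWord.genBound]
    ring
  rcases Nat.lt_or_ge (W.len * W.maxExp * lcmWeight n) 2 with h | h
  · have hone : W.len * W.maxExp * lcmWeight n = 1 := by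
      have : 0 < W.len * W.maxExp * lcmWeight n := by positivity
      omega
    obtain ⟨h12, hlcm⟩ := mul_eq_one.1 hone
    obtain ⟨hlen, -⟩ := mul_eq_one.1 h12
    refine smul_of_level_zero hconn hdom W hlen hlcm hP (fun a => ?_) a m
    have := hgood a 0 (by rw [hB, hone, hlcm]; simp)
    rwa [zero_add] at this
  · refine smul_of_two_periods hconn hdom W hP (fun a m hm => hgood a m (hm.trans_le ?_)) a m
    rw [hB]
    exact_mod_cast Nat.mul_le_mul_right _ h

/-- The elements `x_{m,a}` with `|m| < ℓ r N²` generate the kernel: apply `smul_of_lt_genBound` to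
the cosets `w_m⁻¹ H` of the subgroup `H` that they generate. -/
theorem ker_eq_closure {φ : RAAG Γ →* Multiplicative ℤ}
    (hconn : (Γ.induce (living (weight φ))).Connected)
    (hdom : ZeroAcyclicDominating Γ (living (weight φ))) (W : UnitWord (weight φ)) :
    φ.ker = Subgroup.closure
      {g | ∃ (m : ℤ) (a : V), |m| < (W.genBound : ℤ) ∧ g = W.x Γ (m, a)} := by
  set H := Subgroup.closure
    {g | ∃ (m : ℤ) (a : V), |m| < (W.genBound : ℤ) ∧ g = W.x Γ (m, a)} with hH
  apply le_antisymm
  · let P : ℤ → RAAG Γ ⧸ H := fun m => ((proj Γ (W.w m))⁻¹ : RAAG Γ)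
    have hP : ∀ m, proj Γ (W.w m) • P m = P 0 := by
      intro m
      simp [P]
    have hgood : ∀ a m, |m| < (W.genBound : ℤ) →
        proj Γ (FreeGroup.of a) • P (m + weight φ a) = P m := by
      intro a m hm
      have hx : W.x Γ (m, a) ∈ H := Subgroup.subset_closure ⟨m, a, hm, rfl⟩
      have hx' : proj Γ (W.w m) * proj Γ (FreeGroup.of a) *
          (proj Γ (W.w (m + weight φ a)))⁻¹ ∈ H := by
        simpa [UnitWord.x, UnitWord.xFree] using hx
      refine (QuotientGroup.eq.2 ?_).symm
      rw [inv_inv]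
      change proj Γ (W.w m) *
        (proj Γ (FreeGroup.of a) * (proj Γ (W.w (m + weight φ a)))⁻¹) ∈ H
      rwa [← mul_assoc]
    have hall := smul_of_lt_genBound hconn hdom W hP hgood
    intro g hg
    obtain ⟨u, rfl⟩ := proj_surjective Γ g
    have h1 := proj_smul_of_forall_vertex hall u 0
    rw [(proj_mem_ker_iff φ u).1 hg, add_zero] at h1
    have h2 : ((proj Γ u : RAAG Γ) : RAAG Γ ⧸ H) = ((1 : RAAG Γ) : RAAG Γ ⧸ H) := by
      simpa [P, MulAction.Quotient.smul_coe] using h1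
    simpa using QuotientGroup.eq.1 h2.symm
  · rw [hH, Subgroup.closure_le]
    rintro _ ⟨m, a, -, rfl⟩
    exact W.x_mem_ker _

theorem nonempty_unitWord {φ : RAAG Γ →* Multiplicative ℤ} (hφ : Function.Surjective φ) :
    Nonempty (UnitWord (weight φ)) := by
  classical
  obtain ⟨g, hg⟩ := hφ (Multiplicative.ofAdd 1)
  obtain ⟨u, rfl⟩ := proj_surjective Γ g
  have hu : level (weight φ) u = 1 := by rw [← toAdd_proj, hg, toAdd_ofAdd]
  have hmem : ∀ u, level (weight φ) u ∈ Ideal.span (Set.range (weight φ)) := by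
    intro u
    induction u using FreeGroup.induction_on with
    | C1 => simp
    | of a => exact Ideal.subset_span ⟨a, (level_of _ a).symm⟩
    | inv_of a h => simpa using h
    | mul u v hu hv => simpa using add_mem hu hv
  -- Bézout coefficients; the vertices with zero contribution are then dropped.
  obtain ⟨c, hc⟩ := Ideal.mem_span_range_iff_exists_fun.1 (hu ▸ hmem u)
  let S : Finset V := Finset.univ.filter fun a => c a * weight φ a ≠ 0
  have hS : ∀ j : Fin S.card, c (S.equivFin.symm j) * weight φ (S.equivFin.symm j) ≠ 0 :=
    fun j => (Finset.mem_filter.1 (S.equivFin.symm j).2).2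
  refine ⟨⟨S.card, fun j => S.equivFin.symm j,
    Subtype.val_injective.comp S.equivFin.symm.injective, fun j => c (S.equivFin.symm j),
    fun j => left_ne_zero_of_mul (hS j), fun j => right_ne_zero_of_mul (hS j), ?_⟩⟩
  rw [S.equivFin.symm.sum_comp fun a : S => weight φ a * c a,
    Finset.sum_coe_sort S fun a => weight φ a * c a, ← hc]
  simp_rw [mul_comm (weight φ _)]
  exact Finset.sum_filter_ne_zero _

theorem finite_setOf_x {n : V → ℤ} (W : UnitWord n) :
    {g | ∃ (m : ℤ) (a : V), |m| < (W.genBound : ℤ) ∧ g = W.x Γ (m, a)}.Finite := by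
  refine ((Set.finite_Ioo (-(W.genBound : ℤ)) W.genBound).prod Set.finite_univ |>.image
    (W.x Γ)).subset ?_
  rintro _ ⟨m, a, hm, rfl⟩
  exact ⟨(m, a), ⟨abs_lt.1 hm, Set.mem_univ a⟩, rfl⟩

end Bound

end RAAG

/-! ### Necessity: affine actions on the rationals -/

namespace RAAG

/-- A finitely generated additive subgroup of `ℚ` that is closed under halving is trivial, because
its elements have a common denominator. -/
theorem eq_zero_of_fg_of_half_mem {S : AddSubgroup ℚ} (hS : S.FG)
    (hhalf : ∀ s ∈ S, s / 2 ∈ S) {s : ℚ} (hs : s ∈ S) : s = 0 := by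
  obtain ⟨t, rfl⟩ := hS
  have hden : ∀ s ∈ AddSubgroup.closure (t : Set ℚ), ∃ z : ℤ, s * (∏ q ∈ t, q.den : ℕ) = z := by
    intro s hs
    induction hs using AddSubgroup.closure_induction with
    | mem q hq =>
      obtain ⟨c, hc⟩ := Finset.dvd_prod_of_mem (fun q : ℚ => q.den) hq
      refine ⟨q.num * c, ?_⟩
      rw [hc]
      push_cast
      rw [← mul_assoc, Rat.mul_den_eq_num]
    | zero => exact ⟨0, by simp⟩
    | add x y _ _ hx hy =>
      obtain ⟨z, hz⟩ := hx
      obtain ⟨z', hz'⟩ := hy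
      exact ⟨z + z', by rw [Int.cast_add, ← hz, ← hz', add_mul]⟩
    | neg x _ hx =>
      obtain ⟨z, hz⟩ := hx
      exact ⟨-z, by rw [Int.cast_neg, ← hz, neg_mul]⟩
  have hD : ((∏ q ∈ t, q.den : ℕ) : ℚ) ≠ 0 := by
    exact_mod_cast Finset.prod_ne_zero_iff.2 fun (q : ℚ) _ => q.den_nz
  have hpow : ∀ k : ℕ, s / 2 ^ k ∈ AddSubgroup.closure (t : Set ℚ) := by
    intro k
    induction k with
    | zero => simpa using hs
    | succ k ih =>
      have := hhalf _ ih
      rwa [div_div, ← pow_succ] at this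
  obtain ⟨z, hz⟩ := hden s hs
  by_contra hs0
  have hz0 : z ≠ 0 := by
    rintro rfl
    exact mul_ne_zero hs0 hD (by simpa using hz)
  obtain ⟨k, hk⟩ : ∃ k : ℕ, z.natAbs < 2 ^ k := ⟨_, Nat.lt_two_pow_self⟩
  obtain ⟨z', hz'⟩ := hden _ (hpow k)
  have hzz : z = 2 ^ k * z' := by
    have : (z : ℚ) = 2 ^ k * z' := by
      rw [← hz, ← hz']
      field_simp
    exact_mod_cast this
  have hle := Int.natAbs_dvd_natAbs.2 (Dvd.intro _ hzz.symm)
  have := Nat.le_of_dvd (Int.natAbs_pos.2 hz0) hle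
  rw [Int.natAbs_pow] at this
  simp at this
  omega

/-- A group that maps onto `ℤ` with finitely generated kernel cannot act on `ℚ` by affine maps,
with the slope of `g` being the power of `2` given by its image in `ℤ`, unless the kernel acts
trivially: the translations by elements of the kernel are closed under halving. -/
theorem apply_zero_eq_zero_of_ker_fg {G : Type*} [Group G] {φ : G →* Multiplicative ℤ}
    (hφ : Function.Surjective φ) (hfg : φ.ker.FG) (ρ : G →* Equiv.Perm ℚ)
    (hρ : ∀ g z, ρ g z = 2 ^ (φ g).toAdd * z + ρ g 0) {g : G} (hg : g ∈ φ.ker) : ρ g 0 = 0 := by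
  have hker : ∀ g ∈ φ.ker, ∀ z, ρ g z = z + ρ g 0 := by
    intro g hg z
    rw [hρ g z, MonoidHom.mem_ker.1 hg]
    simp
  let δ : Additive φ.ker →+ ℚ := AddMonoidHom.mk' (fun g => ρ (g.toMul : G) 0) (by
    intro g h
    rw [toMul_add, Subgroup.coe_mul, map_mul, Equiv.Perm.mul_apply, hker _ g.toMul.2, add_comm])
  have hfgG : Group.FG φ.ker := (Group.fg_iff_subgroup_fg _).2 hfg
  have hS : δ.range.FG := (AddGroup.fg_iff_addSubgroup_fg _).1 (AddGroup.fg_range δ)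
  -- Conjugation by an element of level `-1` halves the translations.
  obtain ⟨τ, hτ⟩ := hφ (Multiplicative.ofAdd (-1))
  refine eq_zero_of_fg_of_half_mem hS ?_ ⟨Additive.ofMul ⟨g, hg⟩, rfl⟩
  rintro _ ⟨h', rfl⟩
  obtain ⟨⟨h, hh⟩, rfl⟩ := Additive.ofMul.surjective h'
  have hc : τ * h * τ⁻¹ ∈ φ.ker := (MonoidHom.normal_ker φ).conj_mem h hh τ
  refine ⟨Additive.ofMul ⟨τ * h * τ⁻¹, hc⟩, ?_⟩
  change ρ (τ * h * τ⁻¹) 0 = ρ h 0 / 2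
  have h1 : ρ τ (ρ τ⁻¹ 0) = 0 := by
    rw [← Equiv.Perm.mul_apply, ← map_mul]
    simp
  rw [hρ τ, hτ] at h1
  rw [map_mul, map_mul, Equiv.Perm.mul_apply, Equiv.Perm.mul_apply, hker h hh, hρ τ, hτ]
  simp at h1 ⊢
  linarith

section Affine

variable {V : Type*} {Γ : SimpleGraph V}

theorem exists_hom_of_commute {G : Type*} [Group G] (f : V → G)
    (hf : ∀ a b, Γ.Adj a b → Commute (f a) (f b)) : ∃ ρ : RAAG Γ →* G,
      ∀ a, ρ (proj Γ (FreeGroup.of a)) = f a := by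
  have hrel : ∀ r ∈ raagRels Γ, FreeGroup.lift f r = 1 := by
    rintro r ⟨a, b, hab, rfl⟩
    simp [(hf a b hab).eq]
  exact ⟨PresentedGroup.toGroup hrel, fun a => PresentedGroup.toGroup.of hrel⟩

/-- If every vertex acts on `ℚ` by an affine map of slope `2 ^ n_a`, then `g` acts with slope
`2 ^ φ g`. -/
theorem affine_of_vertices {φ : RAAG Γ →* Multiplicative ℤ} {ρ : RAAG Γ →* Equiv.Perm ℚ}
    (h : ∀ a, ∃ c : ℚ, ∀ z, ρ (proj Γ (FreeGroup.of a)) z = 2 ^ weight φ a * z + c)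
    (g : RAAG Γ) (z : ℚ) : ρ g z = 2 ^ (φ g).toAdd * z + ρ g 0 := by
  suffices H : ∃ c : ℚ, ∀ z, ρ g z = 2 ^ (φ g).toAdd * z + c by
    obtain ⟨c, hc⟩ := H
    rw [hc z, hc 0]
    simp
  obtain ⟨u, rfl⟩ := PresentedGroup.mk_surjective _ g
  change ∃ c : ℚ, ∀ z, ρ (proj Γ u) z = 2 ^ (φ (proj Γ u)).toAdd * z + c
  induction u using FreeGroup.induction_on with
  | C1 => exact ⟨0, by simp⟩
  | of a => exact h a
  | inv_of a ih =>
    obtain ⟨c, hc⟩ := ih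
    refine ⟨-(2 ^ (-(φ (proj Γ (FreeGroup.of a))).toAdd) * c), fun z => ?_⟩
    rw [map_inv, map_inv, Equiv.Perm.inv_eq_iff_eq, hc, map_inv, toAdd_inv, zpow_neg]
    field_simp
    ring
  | mul u v hu hv =>
    obtain ⟨c, hc⟩ := hu
    obtain ⟨d, hd⟩ := hv
    refine ⟨2 ^ (φ (proj Γ u)).toAdd * d + c, fun z => ?_⟩
    rw [map_mul, map_mul, Equiv.Perm.mul_apply, hd, hc, map_mul, toAdd_mul,
      zpow_add₀ (by norm_num)]
    ring

/-- The homothety `z ↦ 2 z` of `ℚ`. -/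
def double : Equiv.Perm ℚ := Equiv.mulLeft₀ 2 (by norm_num)

theorem double_zpow_apply (k : ℤ) (z : ℚ) : (double ^ k) z = 2 ^ k * z := by
  induction k generalizing z with
  | zero => simp
  | succ k ih =>
    rw [zpow_add_one, Equiv.Perm.mul_apply, ih, zpow_add_one₀ (by norm_num)]
    simp [double]
    ring
  | pred k ih =>
    rw [zpow_sub_one, Equiv.Perm.mul_apply, ih, zpow_sub_one₀ (by norm_num)]
    simp [double]
    ring

theorem conj_double_zpow_apply (k : ℤ) (z : ℚ) :
    ((Equiv.addRight (1 : ℚ) * double * (Equiv.addRight (1 : ℚ))⁻¹) ^ k) z =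
      2 ^ k * z + (1 - 2 ^ k) := by
  rw [conj_zpow, Equiv.Perm.mul_apply, Equiv.Perm.mul_apply]
  simp [double_zpow_apply]
  ring

/-- A dead vertex without living neighbours acts by a translation, the living vertices by
homotheties; the other dead vertices act trivially. -/
theorem zeroAcyclicDominating_of_ker_fg {φ : RAAG Γ →* Multiplicative ℤ}
    (hφ : Function.Surjective φ) (hfg : φ.ker.FG) :
    ZeroAcyclicDominating Γ (living (weight φ)) := by
  classical
  intro a ha
  by_contra! hnb
  have ha0 : weight φ a = 0 := by simpa [living] using ha
  obtain ⟨ρ, hρ⟩ := exists_hom_of_commute (Γ := Γ)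
    (fun b => if b = a then Equiv.addRight (1 : ℚ) else double ^ weight φ b) (by
      intro b c hbc
      split_ifs with hb hc hc
      · exact Commute.refl _
      · have : weight φ c = 0 := by
          by_contra hc0
          exact hnb c hc0 (hb ▸ hbc)
        simp [this]
      · have : weight φ b = 0 := by
          by_contra hb0
          exact hnb b hb0 (hc ▸ hbc.symm)
        simp [this]
      · exact Commute.zpow_zpow_self _ _ _)
  have haff := affine_of_vertices (φ := φ) (ρ := ρ) (by
    intro b
    rw [hρ]
    split_ifs with hb
    · exact ⟨1, fun z => by simp [hb, ha0]⟩
    · exact ⟨0, fun z => by simp [double_zpow_apply]⟩)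
  have hker : proj Γ (FreeGroup.of a) ∈ φ.ker := MonoidHom.mem_ker.2 (toAdd_eq_zero.1 ha0)
  have := apply_zero_eq_zero_of_ker_fg hφ hfg ρ haff hker
  rw [hρ] at this
  simp at this

/-- If the living vertices fall into two parts without edges between them, one part acts by
homotheties with centre `0`, the other by homotheties with centre `1`. -/
theorem connected_of_ker_fg {φ : RAAG Γ →* Multiplicative ℤ}
    (hφ : Function.Surjective φ) (hfg : φ.ker.FG) :
    (Γ.induce (living (weight φ))).Connected := by
  classical
  have hne : Nonempty (living (weight φ)) := by
    by_contra hempty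
    have hw : ∀ a, weight φ a = 0 := fun a => by
      by_contra ha
      exact hempty ⟨⟨a, ha⟩⟩
    have h1 : φ = 1 := PresentedGroup.ext fun a => toAdd_eq_zero.1 (hw a)
    obtain ⟨g, hg⟩ := hφ (Multiplicative.ofAdd 1)
    rw [h1, MonoidHom.one_apply] at hg
    exact absurd (congrArg Multiplicative.toAdd hg) (by simp)
  refine { preconnected := fun u v => ?_, nonempty := hne }
  by_contra huv
  -- `near` is the component of `u` in the graph of living vertices.
  let near : V → Prop := fun a => ∃ h : a ∈ living (weight φ),
    (Γ.induce (living (weight φ))).Reachable u ⟨a, h⟩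
  have hnear : ∀ a b, Γ.Adj a b → weight φ a ≠ 0 → weight φ b ≠ 0 → near a → near b := by
    rintro a b hab ha hb ⟨h, hr⟩
    exact ⟨hb, hr.trans (SimpleGraph.Adj.reachable (by simpa using hab))⟩
  obtain ⟨ρ, hρ⟩ := exists_hom_of_commute (Γ := Γ)
    (fun a => if near a then double ^ weight φ a else
      (Equiv.addRight (1 : ℚ) * double * (Equiv.addRight (1 : ℚ))⁻¹) ^ weight φ a) (by
      intro a b hab
      by_cases ha : weight φ a = 0
      · simp [ha]
      by_cases hb : weight φ b = 0
      · simp [hb]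
      have := hnear a b hab ha hb
      have := hnear b a hab.symm hb ha
      split_ifs
      · exact Commute.zpow_zpow_self _ _ _
      · tauto
      · tauto
      · exact Commute.zpow_zpow_self _ _ _)
  have haff := affine_of_vertices (φ := φ) (ρ := ρ) (by
    intro b
    rw [hρ]
    split_ifs
    · exact ⟨0, fun z => by simp [double_zpow_apply]⟩
    · exact ⟨1 - 2 ^ weight φ b, fun z => conj_double_zpow_apply _ _⟩)
  have hu : near u := ⟨u.2, SimpleGraph.Reachable.refl _⟩
  have hv : ¬ near v := fun ⟨_, h⟩ => huv h
  -- `u ^ n_v * v ^ (-n_u)` lies in the kernel and moves `0`.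
  have hker : proj Γ (FreeGroup.of (u : V)) ^ weight φ v *
      (proj Γ (FreeGroup.of (v : V)) ^ weight φ u)⁻¹ ∈ φ.ker := by
    rw [MonoidHom.mem_ker]
    apply Multiplicative.toAdd.injective
    have e1 : (φ (proj Γ (FreeGroup.of (u : V)))).toAdd = weight φ u := rfl
    have e2 : (φ (proj Γ (FreeGroup.of (v : V)))).toAdd = weight φ v := rfl
    simp [e1, e2, mul_comm]
  have h0 := apply_zero_eq_zero_of_ker_fg hφ hfg ρ haff hker
  rw [map_mul, map_inv, map_zpow, map_zpow, hρ, hρ, if_pos hu, if_neg hv, ← zpow_mul, ← zpow_mul,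
    ← zpow_neg, Equiv.Perm.mul_apply, conj_double_zpow_apply, double_zpow_apply] at h0
  have h2 : (2 : ℚ) ^ (-(weight φ v * weight φ u)) = 1 := by
    have : (2 : ℚ) ^ (weight φ u * weight φ v) ≠ 0 := by positivity
    rcases mul_eq_zero.1 h0 with h | h
    · exact absurd h this
    · linarith
  rw [zpow_eq_one_iff_right₀ (by norm_num) (by norm_num)] at h2
  exact mul_ne_zero v.2 u.2 (neg_eq_zero.1 h2)

end Affine

end RAAG

theorem theorem3p5 {V : Type*} [Fintype V] (Γ : SimpleGraph V)
    (φ : RAAG Γ →* Multiplicative ℤ) (hφ : Function.Surjective φ) :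
    (φ.ker.FG ↔
      (Γ.induce (RAAG.living (RAAG.weight φ))).Connected ∧
        RAAG.ZeroAcyclicDominating Γ (RAAG.living (RAAG.weight φ))) ∧
    ((Γ.induce (RAAG.living (RAAG.weight φ))).Connected →
      RAAG.ZeroAcyclicDominating Γ (RAAG.living (RAAG.weight φ)) →
      ∀ W : RAAG.UnitWord (RAAG.weight φ),
        φ.ker = Subgroup.closure
          {g | ∃ (m : ℤ) (a : V), |m| < (W.genBound : ℤ) ∧ g = W.x Γ (m, a)} ∧
        Nonempty (RAAG.Expressions Γ W) ∧
        ∀ E : RAAG.Expressions Γ W,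
          ∃ e : PresentedGroup (RAAG.kernelRels E) ≃* φ.ker,
            ∀ p : W.Gen, (e (PresentedGroup.of p) : RAAG Γ) = W.x Γ p.1) := by
  refine ⟨⟨fun h => ⟨RAAG.connected_of_ker_fg hφ h, RAAG.zeroAcyclicDominating_of_ker_fg hφ h⟩, ?_⟩,
    fun hconn hdom W => ?_⟩
  · rintro ⟨hconn, hdom⟩
    obtain ⟨W⟩ := RAAG.nonempty_unitWord hφ
    rw [RAAG.ker_eq_closure hconn hdom W, Subgroup.fg_iff]
    exact ⟨_, rfl, RAAG.finite_setOf_x W⟩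
  · have hgen := RAAG.ker_eq_closure hconn hdom W
    exact ⟨hgen, RAAG.nonempty_expressions hgen.le, RAAG.exists_kernelRels_mulEquiv hgen.le⟩
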